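/- For an integer $n\ge 1$ and reals $\lambda,\mu,\alpha>0$, let $X$ be the number of customers in the Erlang-A ($M/M/n+M$) system, i.e. the continuous-time birth-death chain on $\{0,1,2,\dots\}$ with birth rate $\lambda$ in every state and death rate $\mu\,(k\wedge n)+\alpha\,(k-n)^+$ in state $k$. This chain is positive recurrent; let $X(\infty)$ have its stationary distribution. Put $R=\lambda/\mu$, and let $x(\infty)$ be the unique solution of $\lambda=(x(\infty)\wedge n)\mu+(x(\infty)-n)^+\alpha$, that is, $x(\infty)=n+(\lambda-n\mu)/\alpha$ if $R\ge n$ and $x(\infty)=R$ if $R<n$. Let $$\tilde X(\infty)=\frac{X(\infty)-x(\infty)}{\sqrt R},\qquad \zeta=\frac{x(\infty)-n}{\sqrt R},$$ $$b(x)=\big[(x+\zeta)^--\zeta^-\big]\mu-\big[(x+\zeta)^+-\zeta^+\big]\alpha ,\qquad x\in\mathbb R,$$ where $a^+=\max(a,0)$ and $a^-=\max(-a,0)$, and let $Y(\infty)$ be a real random variable with density $\kappa\exp\big(\frac1\mu\int_0^x b(y)\,dy\big)$, where $\kappa>0$ is the normalizing constant. For real random variables $U,V$ let $d_K(U,V)=\sup_{a\in\mathbb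 R}|\mathbb P(U\le a)-\mathbb P(V\le a)|$. Theorem. There exists an increasing function $C_K:[0,\infty)\to[0,\infty)$ such that for all integers $n\ge1$ and all $\lambda,\mu,\alpha>0$ with $R\ge 1$, $$d_K(\tilde X(\infty),Y(\infty))\le \frac{C_K(\alpha/\mu)}{\sqrt R}.$$ -/

import Mathlib

open MeasureTheory
open scoped ENNReal

noncomputable section

namespace ErlangA

/-! ### Birth-death chains in continuous time -/

/-- `jumpTransition birth death m i j t` is the probability that the continuous-time birth-death
chain on `ℕ` with birth rates `birth` and death rates `death` (where `death 0 = 0`), started in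
state `i`, is in state `j` at time `t` after exactly `m` jumps. In state `i` the chain stays for an
exponential time of rate `birth i + death i`, and then jumps to `i + 1` or `i - 1` with
probabilities proportional to `birth i` and `death i`. -/
def jumpTransition (birth death : ℕ → ℝ) : ℕ → ℕ → ℕ → ℝ → ℝ≥0∞
  | 0, i, j, t => if i = j then ENNReal.ofReal (Real.exp (-(birth i + death i) * t)) else 0
  | m + 1, i, j, t =>
      ∫⁻ s in Set.Icc 0 t, ENNReal.ofReal (Real.exp (-(birth i + death i) * s)) *
        (ENNReal.ofReal (birth i) * jumpTransition birth death m (i + 1) j (t - s) +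
          ENNReal.ofReal (death i) * jumpTransition birth death m (i - 1) j (t - s))

/-- The transition function `P(X(t) = j | X(0) = i)` of the birth-death chain. -/
def transition (birth death : ℕ → ℝ) (i j : ℕ) (t : ℝ) : ℝ≥0∞ :=
  ∑' m : ℕ, jumpTransition birth death m i j t

/-- `π` is a stationary distribution of the birth-death chain: a probability measure on the states
such that, if `X(0)` has law `π`, then `X(t)` has law `π` for all `t ≥ 0`. -/
structure IsStationaryDistribution (birth death : ℕ → ℝ) (π : Measure ℕ) : Prop where
  isProbabilityMeasure : IsProbabilityMeasure π
  invariant : ∀ t : ℝ, 0 ≤ t → ∀ j : ℕ, ∑' i : ℕ, π {i} * transition birth death i j t = π {j}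

/-! ### The Erlang-A system -/

/-- Arrivals occur at rate `lam` in every state. -/
def arrivalRate (lam : ℝ) (_k : ℕ) : ℝ := lam

/-- The departure rate with `k` customers in the system: `μ (k ∧ n) + α (k - n)⁺`. -/
def departureRate (n : ℕ) (μ α : ℝ) (k : ℕ) : ℝ :=
  min (k : ℝ) n * μ + max ((k : ℝ) - n) 0 * α

/-- `π` is the law of `X(∞)`, the stationary number of customers in the Erlang-A system. -/
def IsStationaryCustomerLaw (n : ℕ) (lam μ α : ℝ) (π : Measure ℕ) : Prop :=
  IsStationaryDistribution (arrivalRate lam) (departureRate n μ α) π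

/-- The offered load `R = lam / μ`. -/
def offeredLoad (lam μ : ℝ) : ℝ := lam / μ

/-- The fluid equilibrium `x(∞)`. -/
def fluidEquilibrium (n : ℕ) (lam μ α : ℝ) : ℝ :=
  if (n : ℝ) ≤ offeredLoad lam μ then n + (lam - n * μ) / α else offeredLoad lam μ

/-- The fluid equilibrium is the unique solution of the flow balance equation. -/
theorem flowBalance_iff (n : ℕ) {lam μ α : ℝ} (hμ : 0 < μ) (hα : 0 < α) (x : ℝ) :
    lam = min x n * μ + max (x - n) 0 * α ↔ x = fluidEquilibrium n lam μ α := by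
  unfold fluidEquilibrium offeredLoad
  split_ifs with h
  · rw [le_div_iff₀ hμ] at h
    have key : x = n + (lam - n * μ) / α ↔ (x - n) * α = lam - n * μ := by
      rw [← eq_div_iff hα.ne', sub_eq_iff_eq_add']
    rw [key]
    rcases le_total x n with hx | hx
    · rw [min_eq_left hx, max_eq_right (by linarith)]
      constructor <;> intro h1
      · have : (x - n) * μ ≥ 0 := by linarith
        have hxn : x = n := by nlinarith
        subst hxn
        linarith
      · have : (x - n) * α ≥ 0 := by linarith
        have hxn : x = n := by nlinarith
        subst hxn
        linarith
    · rw [min_eq_right hx, max_eq_left (by linarith)]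
      constructor <;> intro h1 <;> linarith
  · rw [le_div_iff₀ hμ, not_le] at h
    rw [eq_div_iff hμ.ne']
    rcases le_total x n with hx | hx
    · rw [min_eq_left hx, max_eq_right (by linarith)]
      constructor <;> intro h1 <;> linarith
    · rw [min_eq_right hx, max_eq_left (by linarith)]
      constructor <;> intro h1
      · nlinarith [mul_nonneg (sub_nonneg.2 hx) hα.le]
      · nlinarith

/-- The law of the scaled variable `(X(∞) - x(∞)) / √R`, where `X(∞)` has law `π`. -/
def scaledLaw (n : ℕ) (lam μ α : ℝ) (π : Measure ℕ) : Measure ℝ :=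
  π.map fun k : ℕ => ((k : ℝ) - fluidEquilibrium n lam μ α) / √(offeredLoad lam μ)

/-! ### The diffusion approximation -/

/-- `ζ = (x(∞) - n) / √R`. -/
def zeta (n : ℕ) (lam μ α : ℝ) : ℝ :=
  (fluidEquilibrium n lam μ α - n) / √(offeredLoad lam μ)

/-- The drift `b(x) = [(x + ζ)⁻ - ζ⁻] μ - [(x + ζ)⁺ - ζ⁺] α`, where `a⁺ = max a 0` and
`a⁻ = max (-a) 0`. -/
def drift (n : ℕ) (lam μ α : ℝ) (x : ℝ) : ℝ :=
  (max (-(x + zeta n lam μ α)) 0 - max (-zeta n lam μ α) 0) * μ -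
    (max (x + zeta n lam μ α) 0 - max (zeta n lam μ α) 0) * α

/-- The unnormalized density `exp ((1/μ) ∫₀ˣ b(y) dy)`. -/
def unnormalizedDensity (n : ℕ) (lam μ α : ℝ) (x : ℝ) : ℝ :=
  Real.exp (1 / μ * ∫ y in (0 : ℝ)..x, drift n lam μ α y)

/-- The law of `Y(∞)`: its density is `unnormalizedDensity` times the normalizing constant. -/
def diffusionLaw (n : ℕ) (lam μ α : ℝ) : Measure ℝ :=
  volume.withDensity fun x => ENNReal.ofReal
    ((∫ y, unnormalizedDensity n lam μ α y)⁻¹ * unnormalizedDensity n lam μ α x)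

/-! ### The Kolmogorov distance -/

/-- The Kolmogorov distance between (random variables with) laws `P` and `Q`: the supremum over
`a` of the difference of the expectations of the indicator of `(-∞, a]`. -/
def kolmogorovDist (P Q : Measure ℝ) : ℝ :=
  ⨆ a : ℝ, |P.real (Set.Iic a) - Q.real (Set.Iic a)|

end ErlangA

end

open Filter Topology

noncomputable section

namespace ErlangA

/-! ### Detailed balance -/

section DetailedBalance

variable {birth death : ℕ → ℝ}

/-! The argument is Stein's method, normalised to service rate one, with `c = α / μ`. Let `B` be the
drift of the diffusion and `ν` its unnormalized density, so `ν' = B ν`. For each `a`, let `g` solve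
`g' + B g = 1_{(-∞, a]} - P(Y ≤ a)`. Averaging the left side over the scaled chain gives exactly the
difference of distribution functions at `a`, so it suffices to show that this average is `O(1/√R)`.

Stationarity yields detailed balance `R p_k = D_{k+1} p_{k+1}`, hence the sum of `p_k (R g(x_{k+1})
- D_k g(x_k))` telescopes to a vanishing boundary term. As `(R - D_k)/√R` is exactly `B(x_k)`,
dividing by `√R` leaves `√R (g(x_{k+1}) - g(x_k)) + B(x_k) g(x_k)`. The only error is thus the
replacement of a difference quotient of mesh `1/√R` by `g'`. Since the Stein equation is tested
against `g` itself, and not its antiderivative, a first-order Taylor estimate suffices.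

Away from `a` that error is at most `(2|B(x_k)| + L)/√R`, where `L` bounds the increments of `B`
times `g`. The mean of `|B|` is controlled by the second moment bound `sum_range_mul_sq_le`. The
cell containing the jump at `a` contributes at most `4 p_k`, which is `O(1/√R)` by the bound
`mul_sqrt_le_exp` on atoms.

The delicate point is uniformity in the load and in small `c`: `g` can be of order `1/c` to the
right of the kink, but there `B` has slope only `-c`, so `L` stays bounded
(`piecewiseDrift_sub_mul_steinSolution_le`). -/

theorem const_le_jumpTransition_one {i j : ℕ} {r Q t : ℝ} (hr : 0 ≤ r)
    (hi : birth i + death i ≤ Q) (hj : birth j + death j ≤ Q)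
    (hrate : ∀ s : ℝ, ENNReal.ofReal r * jumpTransition birth death 0 j j s ≤
      ENNReal.ofReal (birth i) * jumpTransition birth death 0 (i + 1) j s +
        ENNReal.ofReal (death i) * jumpTransition birth death 0 (i - 1) j s) :
    ENNReal.ofReal (r * t * Real.exp (-Q * t)) ≤ jumpTransition birth death 1 i j t := by
  have hconst : ENNReal.ofReal (r * t * Real.exp (-Q * t)) =
      ∫⁻ _ in Set.Icc 0 t, ENNReal.ofReal (r * Real.exp (-Q * t)) := by
    rw [setLIntegral_const, Real.volume_Icc, ← ENNReal.ofReal_mul (by positivity)]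
    congr 1
    ring
  rw [hconst, jumpTransition]
  refine setLIntegral_mono' measurableSet_Icc fun s hs => ?_
  refine le_trans ?_ (mul_le_mul_right (hrate (t - s)) _)
  rw [jumpTransition, if_pos rfl, ← ENNReal.ofReal_mul hr,
    ← ENNReal.ofReal_mul (Real.exp_nonneg _)]
  refine ENNReal.ofReal_le_ofReal ?_
  -- Whatever the jump time `s`, the times `s` and `t - s` are spent in states of total rate at most
  -- `Q`.
  have h : Real.exp (-Q * t) ≤
      Real.exp (-(birth i + death i) * s) * Real.exp (-(birth j + death j) * (t - s)) := by
    rw [← Real.exp_add]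
    refine Real.exp_le_exp.2 ?_
    nlinarith [mul_le_mul_of_nonneg_right hi hs.1,
      mul_le_mul_of_nonneg_right hj (sub_nonneg.2 hs.2)]
  nlinarith [mul_le_mul_of_nonneg_left h hr]

theorem le_transition_succ (hb : ∀ k, 0 ≤ birth k) {i : ℕ} {Q t : ℝ}
    (hi : birth i + death i ≤ Q) (hj : birth (i + 1) + death (i + 1) ≤ Q) :
    ENNReal.ofReal (birth i * t * Real.exp (-Q * t)) ≤ transition birth death i (i + 1) t :=
  (const_le_jumpTransition_one (hb i) hi hj fun _ => le_self_add).trans (ENNReal.le_tsum 1)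

theorem le_transition_pred (hd : ∀ k, 0 ≤ death k) {i : ℕ} {Q t : ℝ}
    (hi : birth i + death i ≤ Q) (hj : birth (i + 1) + death (i + 1) ≤ Q) :
    ENNReal.ofReal (death (i + 1) * t * Real.exp (-Q * t)) ≤
      transition birth death (i + 1) i t :=
  (const_le_jumpTransition_one (hd (i + 1)) hj hi fun _ => le_add_self).trans
    (ENNReal.le_tsum 1)

theorem le_transition_self (i : ℕ) (t : ℝ) :
    ENNReal.ofReal (Real.exp (-(birth i + death i) * t)) ≤ transition birth death i i t := by
  refine le_trans ?_ (ENNReal.le_tsum 0)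
  simp [jumpTransition]

theorem le_of_forall_mul_exp_le {x y Q : ℝ} (h : ∀ t : ℝ, 0 < t → x * Real.exp (-Q * t) ≤ y) :
    x ≤ y := by
  have hlim : Tendsto (fun t : ℝ => x * Real.exp (-Q * t)) (𝓝[>] 0) (𝓝 x) := by
    have : Continuous fun t : ℝ => x * Real.exp (-Q * t) := by fun_prop
    simpa using (this.tendsto 0).mono_left nhdsWithin_le_nhds
  exact le_of_tendsto hlim (eventually_nhdsWithin_of_forall h)

variable {π : Measure ℕ}

theorem IsStationaryDistribution.sum_le (hπ : IsStationaryDistribution birth death π)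
    {t : ℝ} (ht : 0 ≤ t) (j : ℕ) (s : Finset ℕ) (v : ℕ → ℝ) (hv : ∀ i ∈ s, 0 ≤ v i)
    (h : ∀ i ∈ s, ENNReal.ofReal (v i) ≤ transition birth death i j t) :
    ∑ i ∈ s, π.real {i} * v i ≤ π.real {j} := by
  have := hπ.isProbabilityMeasure
  have hle : ENNReal.ofReal (∑ i ∈ s, π.real {i} * v i) ≤ ENNReal.ofReal (π.real {j}) := by
    rw [ofReal_measureReal, ← hπ.invariant t ht j,
      ENNReal.ofReal_sum_of_nonneg fun i hi => mul_nonneg measureReal_nonneg (hv i hi)]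
    refine le_trans (Finset.sum_le_sum fun i hi => ?_) (ENNReal.sum_le_tsum s)
    rw [ENNReal.ofReal_mul measureReal_nonneg, ofReal_measureReal]
    exact mul_le_mul_right (h i hi) _
  exact (ENNReal.ofReal_le_ofReal_iff measureReal_nonneg).1 hle

/-- This is half of the balance equation at `0`: keeping only paths with at most one jump bounds
`π{0}` from below to first order in `t`. Then `1 - e^{-qt} ≤ qt` is used, `t` is cancelled, and `t →
0`. An inequality is enough, so no differentiability or uniqueness of the transition function is
needed. -/
theorem IsStationaryDistribution.inflow_zero_le (hπ : IsStationaryDistribution birth death π)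
    (hd : ∀ k, 0 ≤ death k) :
    death 1 * π.real {1} ≤ (birth 0 + death 0) * π.real {0} := by
  set Q := max (birth 0 + death 0) (birth 1 + death 1)
  refine le_of_forall_mul_exp_le (Q := Q) fun t ht => ?_
  have h := hπ.sum_le ht.le 0 {0, 1}
    (fun i => if i = 0 then Real.exp (-(birth 0 + death 0) * t) else
      death 1 * t * Real.exp (-Q * t))
    (by
      have := hd 1
      intro i _
      split_ifs <;> positivity)
    (by
      intro i hi
      simp only [Finset.mem_insert, Finset.mem_singleton] at hi
      rcases hi with rfl | rfl
      · exact le_transition_self 0 t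
      · exact le_transition_pred hd (le_max_left _ _) (le_max_right _ _))
  rw [Finset.sum_pair zero_ne_one] at h
  simp only [if_true, one_ne_zero, if_false] at h
  have he := Real.add_one_le_exp (-(birth 0 + death 0) * t)
  have hp : 0 ≤ π.real {0} := measureReal_nonneg
  refine le_of_mul_le_mul_right ?_ ht
  nlinarith [mul_le_mul_of_nonneg_left he hp]

theorem IsStationaryDistribution.inflow_succ_le (hπ : IsStationaryDistribution birth death π)
    (hb : ∀ k, 0 ≤ birth k) (hd : ∀ k, 0 ≤ death k) (j : ℕ) :
    birth j * π.real {j} + death (j + 2) * π.real {j + 2} ≤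
      (birth (j + 1) + death (j + 1)) * π.real {j + 1} := by
  set Q := max (birth j + death j)
    (max (birth (j + 1) + death (j + 1)) (birth (j + 2) + death (j + 2)))
  have hQ0 : birth j + death j ≤ Q := le_max_left _ _
  have hQ1 : birth (j + 1) + death (j + 1) ≤ Q := (le_max_left _ _).trans (le_max_right _ _)
  have hQ2 : birth (j + 2) + death (j + 2) ≤ Q := (le_max_right _ _).trans (le_max_right _ _)
  refine le_of_forall_mul_exp_le (Q := Q) fun t ht => ?_
  have h := hπ.sum_le ht.le (j + 1) {j, j + 1, j + 2}
    (fun i => if i = j then birth j * t * Real.exp (-Q * t) else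
      if i = j + 1 then Real.exp (-(birth (j + 1) + death (j + 1)) * t) else
      death (j + 2) * t * Real.exp (-Q * t))
    (by
      have := hb j
      have := hd (j + 2)
      intro i _
      split_ifs <;> positivity)
    (by
      intro i hi
      simp only [Finset.mem_insert, Finset.mem_singleton] at hi
      rcases hi with rfl | rfl | rfl
      · simpa using le_transition_succ hb hQ0 hQ1
      · simpa using le_transition_self (birth := birth) (death := death) (j + 1) t
      · simpa using le_transition_pred hd hQ1 hQ2)
  rw [Finset.sum_insert (by simp), Finset.sum_pair (by simp)] at h
  simp only [if_true, Nat.succ_ne_self, if_false, show j + 2 ≠ j by omega,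
    show j + 2 ≠ j + 1 by omega] at h
  have he := Real.add_one_le_exp (-(birth (j + 1) + death (j + 1)) * t)
  have hp : 0 ≤ π.real {j + 1} := measureReal_nonneg
  refine le_of_mul_le_mul_right ?_ ht
  nlinarith [mul_le_mul_of_nonneg_left he hp]

theorem hasSum_real_singleton_indicator (π : Measure ℕ) [IsFiniteMeasure π] (s : Set ℕ) :
    HasSum (s.indicator fun k => π.real {k}) (π.real s) := by
  have h := measure_biUnion (μ := π) (s := s) (f := fun k => ({k} : Set ℕ))
    s.to_countable (fun i _ j _ hij => by simpa [Function.onFun] using hij)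
    (fun _ _ => measurableSet_singleton _)
  rw [Set.biUnion_of_singleton, tsum_subtype s fun k => π {k}] at h
  have hfin : ∑' k, s.indicator (fun k => π {k}) k ≠ ∞ := h ▸ measure_ne_top π s
  have h2 := ENNReal.hasSum_toReal hfin
  rw [← ENNReal.tsum_toReal_eq (fun k => ENNReal.ne_top_of_tsum_ne_top hfin k), ← h] at h2
  change HasSum _ (π s).toReal
  convert h2 using 1
  ext k
  by_cases hk : k ∈ s <;> simp [hk, Measure.real]

theorem hasSum_real_singleton (π : Measure ℕ) [IsProbabilityMeasure π] :
    HasSum (fun k => π.real {k}) 1 := by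
  simpa using hasSum_real_singleton_indicator π Set.univ

/-- A stationary distribution of a birth-death chain with constant birth rate satisfies the
detailed balance equations: the probability flux across each edge is nonnegative and nondecreasing,
and it is dominated by a summable sequence. -/
theorem IsStationaryDistribution.detailedBalance {lam : ℝ}
    (hπ : IsStationaryDistribution (arrivalRate lam) death π)
    (hlam : 0 ≤ lam) (hd : ∀ k, 0 ≤ death k) (hd0 : death 0 = 0) (k : ℕ) :
    lam * π.real {k} = death (k + 1) * π.real {k + 1} := by
  have := hπ.isProbabilityMeasure
  set u : ℕ → ℝ := fun k => lam * π.real {k} - death (k + 1) * π.real {k + 1} with hu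
  have hmono : Monotone u := by
    refine monotone_nat_of_le_succ fun j => ?_
    have := hπ.inflow_succ_le (fun _ => hlam) hd j
    simp only [arrivalRate] at this
    simp only [hu]
    linarith
  have h0 : 0 ≤ u 0 := by
    have := hπ.inflow_zero_le hd
    simp only [arrivalRate, hd0, add_zero] at this
    simp only [hu]
    linarith
  have hlim : Tendsto (fun k => lam * π.real {k}) atTop (𝓝 0) := by
    simpa using (hasSum_real_singleton π).summable.tendsto_atTop_zero.const_mul lam
  -- For `m ≥ k`, `u k ≤ u m ≤ lam * π{m}`, and the right side tends to `0`.
  have hk : u k ≤ 0 := by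
    refine ge_of_tendsto hlim ((eventually_ge_atTop k).mono fun m hm => (hmono hm).trans ?_)
    have : 0 ≤ death (m + 1) * π.real {m + 1} := mul_nonneg (hd _) measureReal_nonneg
    simp only [hu]
    linarith
  exact sub_eq_zero.1 (le_antisymm hk (h0.trans (hmono (Nat.zero_le k))))

end DetailedBalance

/-! ### Estimates for birth-death sequences in detailed balance -/

section Discrete

variable {p D : ℕ → ℝ} {R A : ℝ}

/-- If `G` is the backward difference of a function `f`, the bracket is the generator applied to
`f`. Detailed balance makes the sum telescope, leaving only the flux across the last edge. -/
theorem sum_range_generator (hbal : ∀ k, R * p k = D (k + 1) * p (k + 1)) (hD0 : D 0 = 0)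
    (G : ℕ → ℝ) (N : ℕ) :
    ∑ k ∈ Finset.range N, p k * (R * G (k + 1) - D k * G k) = D N * p N * G N := by
  induction N with
  | zero => simp [hD0]
  | succ N ih =>
    rw [Finset.sum_range_succ, ih, ← hbal N]
    ring

theorem sum_range_le_one (hp : ∀ k, 0 ≤ p k) (hsum : HasSum p 1) (N : ℕ) :
    ∑ k ∈ Finset.range N, p k ≤ 1 :=
  sum_le_hasSum _ (fun k _ => hp k) hsum

/-- With `G = R - D` the generator sum has terms `(R - D k)^2 - R (D (k+1) - D k)`, and the
increment of `D` is at most `A`. The boundary term is at most `R^2 p M`, which tends to `0`. -/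
theorem sum_range_mul_sq_le (hbal : ∀ k, R * p k = D (k + 1) * p (k + 1)) (hD0 : D 0 = 0)
    (hD : ∀ k, 0 ≤ D k) (hstep : ∀ k, D (k + 1) ≤ D k + A) (hp : ∀ k, 0 ≤ p k)
    (hsum : HasSum p 1) (hR : 0 ≤ R) (hA : 0 ≤ A) (N : ℕ) :
    ∑ k ∈ Finset.range N, p k * (R - D k) ^ 2 ≤ R * A := by
  have hbound : ∀ M, ∑ k ∈ Finset.range (M + 1), p k * (R - D k) ^ 2 ≤ R * A + R ^ 2 * p M := by
    intro M
    have h := sum_range_generator hbal hD0 (fun k => R - D k) (M + 1)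
    have hterm : ∑ k ∈ Finset.range (M + 1), p k * (R - D k) ^ 2 ≤
        ∑ k ∈ Finset.range (M + 1), (p k * (R * (R - D (k + 1)) - D k * (R - D k)) +
          R * A * p k) := by
      refine Finset.sum_le_sum fun k _ => ?_
      nlinarith [mul_le_mul_of_nonneg_left (hstep k) (mul_nonneg hR (hp k))]
    rw [Finset.sum_add_distrib, h, ← Finset.mul_sum, ← hbal M] at hterm
    have h1 := mul_le_mul_of_nonneg_left (sum_range_le_one hp hsum (M + 1)) (mul_nonneg hR hA)
    nlinarith [mul_nonneg (mul_nonneg hR (hp M)) (hD (M + 1))]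
  have hlim : Tendsto (fun M => R * A + R ^ 2 * p M) atTop (𝓝 (R * A)) := by
    simpa using (hsum.summable.tendsto_atTop_zero.const_mul (R ^ 2)).const_add (R * A)
  refine ge_of_tendsto hlim ((eventually_ge_atTop N).mono fun M hM => (hbound M).trans' ?_)
  exact Finset.sum_le_sum_of_subset_of_nonneg (Finset.range_mono (by omega))
    fun k _ _ => mul_nonneg (hp k) (sq_nonneg _)

/-- Each ratio `p (k+i-1) / p (k+i) = D (k+i) / R` is at most `1 + A i / R ≤ exp (A i / R)`; the
exponents add up to a triangular number. -/
theorem le_mul_exp_of_le (hbal : ∀ k, R * p k = D (k + 1) * p (k + 1))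
    (hstep : ∀ k, D (k + 1) ≤ D k + A) (hp : ∀ k, 0 ≤ p k) (hR : 0 < R)
    {k : ℕ} (hk : D k ≤ R) (j : ℕ) :
    p k ≤ p (k + j) * Real.exp (A / R * (j * (j + 1) / 2)) := by
  have hDj : ∀ j : ℕ, D (k + j) ≤ R + A * j := by
    intro j
    induction j with
    | zero => simpa using hk
    | succ j ih =>
      have := hstep (k + j)
      push_cast
      rw [← add_assoc]
      linarith
  induction j with
  | zero => simp
  | succ j ih =>
    have h1 : p (k + j) ≤ p (k + j + 1) * Real.exp (A / R * (j + 1)) := by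
      have h2 := mul_le_mul_of_nonneg_right (hDj (j + 1)) (hp (k + j + 1))
      rw [← add_assoc, ← hbal (k + j)] at h2
      have h3 := mul_le_mul_of_nonneg_left (Real.add_one_le_exp (A / R * (j + 1)))
        (hp (k + j + 1))
      refine le_trans ?_ h3
      refine le_of_mul_le_mul_left (h2.trans_eq ?_) hR
      push_cast
      field_simp
      ring
    refine ih.trans ((mul_le_mul_of_nonneg_right h1 (Real.exp_nonneg _)).trans_eq ?_)
    rw [mul_assoc, ← Real.exp_add, ← add_assoc]
    congr 2
    push_cast
    ring

/-- Where `D k ≤ R`, the mass decays by at most a factor `e^A` over the next `⌊√R⌋` states, so more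
than `√R` states carry at least `e^{-A} p k` each, with total at most `1`. Where `D ≥ R` the masses
are nonincreasing, and induction carries the bound on. -/
theorem mul_sqrt_le_exp (hbal : ∀ k, R * p k = D (k + 1) * p (k + 1)) (hD0 : D 0 = 0)
    (hstep : ∀ k, D (k + 1) ≤ D k + A) (hp : ∀ k, 0 ≤ p k)
    (hsum : HasSum p 1) (hR : 1 ≤ R) (hA : 0 ≤ A) (k : ℕ) :
    p k * √R ≤ Real.exp A := by
  have hR0 : 0 < R := by linarith
  have key : ∀ k, D k ≤ R → p k * √R ≤ Real.exp A := by
    intro k hk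
    set m := ⌊√R⌋₊
    have hle : ∀ j ∈ Finset.range (m + 1), p k ≤ p (k + j) * Real.exp A := by
      intro j hj
      refine (le_mul_exp_of_le hbal hstep hp hR0 hk j).trans
        (mul_le_mul_of_nonneg_left (Real.exp_le_exp.2 ?_) (hp _))
      have hj1 : (j : ℝ) ≤ √R :=
        (Nat.cast_le.2 (Nat.lt_succ_iff.1 (Finset.mem_range.1 hj))).trans
          (Nat.floor_le (Real.sqrt_nonneg R))
      have hsq : √R * √R = R := Real.mul_self_sqrt hR0.le
      have h1 : 1 ≤ √R := Real.one_le_sqrt.2 hR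
      have h2 : (j : ℝ) * (j + 1) / 2 ≤ R := by
        have hj0 : (0 : ℝ) ≤ j := Nat.cast_nonneg j
        nlinarith [mul_le_mul hj1 hj1 hj0 (Real.sqrt_nonneg R)]
      calc A / R * (j * (j + 1) / 2) ≤ A / R * R :=
            mul_le_mul_of_nonneg_left h2 (div_nonneg hA hR0.le)
        _ = A := div_mul_cancel₀ _ hR0.ne'
    have hs := Finset.sum_le_sum hle
    rw [Finset.sum_const, Finset.card_range, nsmul_eq_mul, ← Finset.sum_mul] at hs
    have hs1 : ∑ j ∈ Finset.range (m + 1), p (k + j) ≤ 1 := by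
      have h := Finset.sum_Ico_eq_sum_range p k (k + (m + 1))
      rw [Nat.add_sub_cancel_left] at h
      rw [← h]
      exact sum_le_hasSum _ (fun k _ => hp k) hsum
    have hm : √R ≤ (m + 1 : ℕ) := by
      push_cast
      exact (Nat.lt_floor_add_one _).le
    calc p k * √R ≤ (m + 1 : ℕ) * p k := by
          rw [mul_comm]
          exact mul_le_mul_of_nonneg_right hm (hp k)
      _ ≤ _ := hs
      _ ≤ 1 * Real.exp A := mul_le_mul_of_nonneg_right hs1 (Real.exp_nonneg _)
      _ = Real.exp A := one_mul _
  induction k with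
  | zero => exact key 0 (by rw [hD0]; exact hR0.le)
  | succ k ih =>
    rcases le_total (D (k + 1)) R with h | h
    · exact key _ h
    · refine le_trans (mul_le_mul_of_nonneg_right ?_ (Real.sqrt_nonneg R)) ih
      refine le_of_mul_le_mul_left ?_ hR0
      rw [hbal k]
      exact mul_le_mul_of_nonneg_right h (hp _)

end Discrete

/-! ### Log-concave densities with antitone drift -/

section Density

/-- The unnormalized density `exp (∫₀ˣ B)` with logarithmic derivative `B`. -/
def driftDensity (B : ℝ → ℝ) (x : ℝ) : ℝ := Real.exp (∫ y in (0 : ℝ)..x, B y)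

/-- The mass that `driftDensity B` puts on `(-∞, x]`. -/
def lowerMass (B : ℝ → ℝ) (x : ℝ) : ℝ := ∫ y in Set.Iic x, driftDensity B y

/-- The mass that `driftDensity B` puts on `(x, ∞)`. -/
def upperMass (B : ℝ → ℝ) (x : ℝ) : ℝ := ∫ y in Set.Ioi x, driftDensity B y

/-- The total mass of `driftDensity B`. -/
def totalMass (B : ℝ → ℝ) : ℝ := ∫ y, driftDensity B y

variable {B : ℝ → ℝ}

theorem driftDensity_pos (B : ℝ → ℝ) (x : ℝ) : 0 < driftDensity B x := Real.exp_pos _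

@[simp] theorem driftDensity_zero (B : ℝ → ℝ) : driftDensity B 0 = 1 := by simp [driftDensity]

theorem hasDerivAt_driftDensity (hB : Continuous B) (x : ℝ) :
    HasDerivAt (driftDensity B) (B x * driftDensity B x) x := by
  have h := (intervalIntegral.integral_hasDerivAt_right (hB.intervalIntegrable 0 x)
    (hB.stronglyMeasurableAtFilter _ _) hB.continuousAt).exp
  rw [mul_comm]
  exact h

theorem continuous_driftDensity (hB : Continuous B) : Continuous (driftDensity B) :=
  continuous_iff_continuousAt.2 fun x => (hasDerivAt_driftDensity hB x).continuousAt

theorem driftDensity_mono_of_nonneg (hB : Continuous B) {x y : ℝ} (hxy : x ≤ y)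
    (h : ∀ u ∈ Set.Icc x y, 0 ≤ B u) : driftDensity B x ≤ driftDensity B y := by
  refine monotoneOn_of_deriv_nonneg (convex_Icc x y) (continuous_driftDensity hB).continuousOn
    (fun u _ => (hasDerivAt_driftDensity hB u).differentiableAt.differentiableWithinAt)
    (fun u hu => ?_) (Set.left_mem_Icc.2 hxy) (Set.right_mem_Icc.2 hxy) hxy
  rw [(hasDerivAt_driftDensity hB u).deriv]
  exact mul_nonneg (h u (interior_subset hu)) (driftDensity_pos B u).le

theorem driftDensity_anti_of_nonpos (hB : Continuous B) {x y : ℝ} (hxy : x ≤ y)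
    (h : ∀ u ∈ Set.Icc x y, B u ≤ 0) : driftDensity B y ≤ driftDensity B x := by
  refine antitoneOn_of_deriv_nonpos (convex_Icc x y) (continuous_driftDensity hB).continuousOn
    (fun u _ => (hasDerivAt_driftDensity hB u).differentiableAt.differentiableWithinAt)
    (fun u hu => ?_) (Set.left_mem_Icc.2 hxy) (Set.right_mem_Icc.2 hxy) hxy
  rw [(hasDerivAt_driftDensity hB u).deriv]
  exact mul_nonpos_of_nonpos_of_nonneg (h u (interior_subset hu)) (driftDensity_pos B u).le

/-- A drift pointing towards the origin with at least linear strength gives Gaussian tails. -/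
theorem integrable_driftDensity (hB : Continuous B) {m : ℝ} (hm : 0 < m)
    (hneg : ∀ x ≤ 0, -m * x ≤ B x) (hpos : ∀ x, 0 ≤ x → B x ≤ -m * x) :
    Integrable (driftDensity B) := by
  refine (integrable_exp_neg_mul_sq (half_pos hm)).mono'
    (continuous_driftDensity hB).aestronglyMeasurable (Eventually.of_forall fun x => ?_)
  rw [Real.norm_of_nonneg (driftDensity_pos B x).le]
  refine Real.exp_le_exp.2 ?_
  have hlin : ∫ y in (0 : ℝ)..x, -m * y = -(m / 2) * x ^ 2 := by
    rw [intervalIntegral.integral_const_mul, integral_id]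
    ring
  have hc : Continuous fun y : ℝ => -m * y := by fun_prop
  rw [← hlin]
  rcases le_total 0 x with hx | hx
  · exact intervalIntegral.integral_mono_on hx (hB.intervalIntegrable _ _)
      (hc.intervalIntegrable _ _) fun y hy => hpos y hy.1
  · rw [intervalIntegral.integral_symm x 0, intervalIntegral.integral_symm x 0]
    exact neg_le_neg (intervalIntegral.integral_mono_on hx (hc.intervalIntegrable _ _)
      (hB.intervalIntegrable _ _) fun y hy => hneg y hy.2)

theorem lowerMass_nonneg (B : ℝ → ℝ) (x : ℝ) : 0 ≤ lowerMass B x :=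
  integral_nonneg fun y => (driftDensity_pos B y).le

theorem upperMass_nonneg (B : ℝ → ℝ) (x : ℝ) : 0 ≤ upperMass B x :=
  integral_nonneg fun y => (driftDensity_pos B y).le

variable (hν : Integrable (driftDensity B))
include hν

theorem lowerMass_add_upperMass (x : ℝ) : lowerMass B x + upperMass B x = totalMass B :=
  intervalIntegral.integral_Iic_add_Ioi hν.integrableOn hν.integrableOn

theorem lowerMass_sub (x y : ℝ) :
    lowerMass B y - lowerMass B x = ∫ u in x..y, driftDensity B u :=
  intervalIntegral.integral_Iic_sub_Iic hν.integrableOn hν.integrableOn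

theorem lowerMass_mono : Monotone (lowerMass B) := by
  intro x y hxy
  have h := lowerMass_sub hν x y
  have h2 : 0 ≤ ∫ u in x..y, driftDensity B u :=
    intervalIntegral.integral_nonneg hxy fun u _ => (driftDensity_pos B u).le
  linarith

theorem upperMass_anti : Antitone (upperMass B) := by
  intro x y hxy
  have h := lowerMass_mono hν hxy
  have hx := lowerMass_add_upperMass hν x
  have hy := lowerMass_add_upperMass hν y
  linarith

theorem totalMass_pos : 0 < totalMass B :=
  (integral_pos_iff_support_of_nonneg (fun x => (driftDensity_pos B x).le) hν).2 (by
    have h : Function.support (driftDensity B) = Set.univ :=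
      Set.eq_univ_of_forall fun x => (driftDensity_pos B x).ne'
    simp [h])

theorem hasDerivAt_lowerMass (hB : Continuous B) (x : ℝ) :
    HasDerivAt (lowerMass B) (driftDensity B x) x := by
  have hc := continuous_driftDensity hB
  have h := (intervalIntegral.integral_hasDerivAt_right (hc.intervalIntegrable 0 x)
    (hc.stronglyMeasurableAtFilter _ _) hc.continuousAt).const_add (lowerMass B 0)
  refine h.congr_of_eventuallyEq (Eventually.of_forall fun y => ?_)
  have := lowerMass_sub hν 0 y
  simp only
  linarith

theorem hasDerivAt_upperMass (hB : Continuous B) (x : ℝ) :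
    HasDerivAt (upperMass B) (-driftDensity B x) x := by
  have h := (hasDerivAt_lowerMass hν hB x).const_sub (totalMass B)
  refine h.congr_of_eventuallyEq (Eventually.of_forall fun y => ?_)
  have := lowerMass_add_upperMass hν y
  linarith

/-- A Mills ratio bound: as `B` is antitone, `B x` times the mass left of `x` is at most the
integral of `B ν = ν'` there, hence at most `ν x`. -/
theorem drift_mul_lowerMass_le (hB : Continuous B) (hanti : Antitone B) (x : ℝ) :
    B x * lowerMass B x ≤ driftDensity B x := by
  rcases le_total (B x) 0 with h0 | h0
  · exact (mul_nonpos_of_nonpos_of_nonneg h0 (lowerMass_nonneg B x)).trans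
      (driftDensity_pos B x).le
  have hlim := (intervalIntegral_tendsto_integral_Iic x hν.integrableOn tendsto_id).const_mul
    (B x)
  refine le_of_tendsto hlim ((eventually_le_atBot x).mono fun u hu => ?_)
  have hc := continuous_driftDensity hB
  have hftc := intervalIntegral.integral_eq_sub_of_hasDerivAt (a := u) (b := x)
    (fun y _ => hasDerivAt_driftDensity hB y) ((hB.mul hc).intervalIntegrable _ _)
  have hle : ∫ y in u..x, B x * driftDensity B y ≤ ∫ y in u..x, B y * driftDensity B y :=
    intervalIntegral.integral_mono_on hu ((continuous_const.mul hc).intervalIntegrable _ _)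
      ((hB.mul hc).intervalIntegrable _ _)
      fun y hy => mul_le_mul_of_nonneg_right (hanti hy.2) (driftDensity_pos B y).le
  rw [intervalIntegral.integral_const_mul, hftc] at hle
  exact hle.trans (sub_le_self _ (driftDensity_pos B u).le)

theorem neg_drift_mul_upperMass_le (hB : Continuous B) (hanti : Antitone B) (x : ℝ) :
    -B x * upperMass B x ≤ driftDensity B x := by
  rcases le_total 0 (B x) with h0 | h0
  · exact (mul_nonpos_of_nonpos_of_nonneg (neg_nonpos.2 h0) (upperMass_nonneg B x)).trans
      (driftDensity_pos B x).le
  have hlim := (intervalIntegral_tendsto_integral_Ioi x hν.integrableOn tendsto_id).const_mul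
    (-B x)
  refine le_of_tendsto hlim ((eventually_ge_atTop x).mono fun u hu => ?_)
  have hc := continuous_driftDensity hB
  have hftc := intervalIntegral.integral_eq_sub_of_hasDerivAt (a := x) (b := u)
    (fun y _ => hasDerivAt_driftDensity hB y) ((hB.mul hc).intervalIntegrable _ _)
  have hle : ∫ y in x..u, B y * driftDensity B y ≤ ∫ y in x..u, B x * driftDensity B y :=
    intervalIntegral.integral_mono_on hu ((hB.mul hc).intervalIntegrable _ _)
      ((continuous_const.mul hc).intervalIntegrable _ _)
      fun y hy => mul_le_mul_of_nonneg_right (hanti hy.1) (driftDensity_pos B y).le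
  rw [intervalIntegral.integral_const_mul, hftc] at hle
  have := driftDensity_pos B u
  simp only [id]
  linarith

/-- The Mills bound fails near a zero of `B`. It is therefore applied one unit further out, where
the drift is at least `m`, and on the unit interval in between the density is at most its value at
`x`. -/
theorem lowerMass_le_of_le_one (hB : Continuous B) (hanti : Antitone B) {x m : ℝ}
    (hx : 0 ≤ B x) (hm : 0 < m) (hm1 : m ≤ B (x - 1)) :
    lowerMass B x ≤ (1 + 1 / m) * driftDensity B x := by
  have hle : ∀ u ∈ Set.Icc (x - 1) x, driftDensity B u ≤ driftDensity B x := fun u hu =>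
    driftDensity_mono_of_nonneg hB hu.2 fun v hv => hx.trans (hanti hv.2)
  have h1 : lowerMass B x - lowerMass B (x - 1) ≤ driftDensity B x := by
    rw [lowerMass_sub hν]
    have := intervalIntegral.integral_mono_on (by linarith : x - 1 ≤ x)
      ((continuous_driftDensity hB).intervalIntegrable _ _)
      (continuous_const.intervalIntegrable (μ := volume) _ _) hle
    simpa using this
  have h2 : lowerMass B (x - 1) ≤ 1 / m * driftDensity B x := by
    rw [div_mul_eq_mul_div, one_mul, le_div_iff₀ hm, mul_comm]
    exact (mul_le_mul_of_nonneg_right hm1 (lowerMass_nonneg B _)).trans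
      ((drift_mul_lowerMass_le hν hB hanti _).trans (hle _ ⟨le_rfl, by linarith⟩))
  linarith

theorem upperMass_le_of_le_one (hB : Continuous B) (hanti : Antitone B) {x m : ℝ}
    (hx : B x ≤ 0) (hm : 0 < m) (hm1 : m ≤ -B (x + 1)) :
    upperMass B x ≤ (1 + 1 / m) * driftDensity B x := by
  have hle : ∀ u ∈ Set.Icc x (x + 1), driftDensity B u ≤ driftDensity B x := fun u hu =>
    driftDensity_anti_of_nonpos hB hu.1 fun v hv => (hanti hv.1).trans hx
  have h1 : upperMass B x - upperMass B (x + 1) ≤ driftDensity B x := by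
    have e : upperMass B x - upperMass B (x + 1) = lowerMass B (x + 1) - lowerMass B x := by
      have h3 := lowerMass_add_upperMass hν x
      have h4 := lowerMass_add_upperMass hν (x + 1)
      linarith
    rw [e, lowerMass_sub hν]
    have := intervalIntegral.integral_mono_on (by linarith : x ≤ x + 1)
      ((continuous_driftDensity hB).intervalIntegrable _ _)
      (continuous_const.intervalIntegrable (μ := volume) _ _) hle
    simpa using this
  have h2 : upperMass B (x + 1) ≤ 1 / m * driftDensity B x := by
    rw [div_mul_eq_mul_div, one_mul, le_div_iff₀ hm, mul_comm]
    exact (mul_le_mul_of_nonneg_right hm1 (upperMass_nonneg B _)).trans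
      ((neg_drift_mul_upperMass_le hν hB hanti _).trans (hle _ ⟨by linarith, le_rfl⟩))
  linarith

end Density

/-! ### The Stein equation for half-lines -/

section Stein

/-- The bounded solution of `g' + B g = 1_{(-∞, a]} - P(Y ≤ a)`, where `Y` has density
proportional to `driftDensity B`. -/
def steinSolution (B : ℝ → ℝ) (a x : ℝ) : ℝ :=
  lowerMass B (min x a) * upperMass B (max x a) / (totalMass B * driftDensity B x)

/-- The value at `x` of the Stein solution for the half-line `(-∞, x]`; it dominates the
solutions for all half-lines. -/
def steinEnvelope (B : ℝ → ℝ) (x : ℝ) : ℝ :=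
  lowerMass B x * upperMass B x / (totalMass B * driftDensity B x)

/-- The derivative of the Stein solution at `x`, if `x ≠ a`. -/
def steinSlope (B : ℝ → ℝ) (a x : ℝ) : ℝ :=
  (if x ≤ a then 1 else 0) - lowerMass B a / totalMass B - B x * steinSolution B a x

variable {B : ℝ → ℝ} {a : ℝ}

theorem steinSolution_of_le {x : ℝ} (hx : x ≤ a) :
    steinSolution B a x = upperMass B a / totalMass B * (lowerMass B x / driftDensity B x) := by
  rw [steinSolution, min_eq_left hx, max_eq_right hx]
  ring

theorem steinSolution_of_ge {x : ℝ} (hx : a ≤ x) :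
    steinSolution B a x = lowerMass B a / totalMass B * (upperMass B x / driftDensity B x) := by
  rw [steinSolution, min_eq_right hx, max_eq_left hx]
  ring

variable (hν : Integrable (driftDensity B))
include hν

theorem steinSolution_nonneg (a x : ℝ) : 0 ≤ steinSolution B a x :=
  div_nonneg (mul_nonneg (lowerMass_nonneg B _) (upperMass_nonneg B _))
    (mul_pos (totalMass_pos hν) (driftDensity_pos B x)).le

theorem steinSolution_le_envelope (a x : ℝ) : steinSolution B a x ≤ steinEnvelope B x := by
  refine div_le_div_of_nonneg_right ?_ (mul_pos (totalMass_pos hν) (driftDensity_pos B x)).le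
  exact mul_le_mul (lowerMass_mono hν (min_le_left _ _)) (upperMass_anti hν (le_max_left _ _))
    (upperMass_nonneg B _) (lowerMass_nonneg B _)

theorem steinEnvelope_le_of_lowerMass_le {x M : ℝ} (h : lowerMass B x ≤ M * driftDensity B x) :
    steinEnvelope B x ≤ M := by
  have hZ := totalMass_pos hν
  have hT : upperMass B x ≤ totalMass B := by
    linarith [lowerMass_add_upperMass hν x, lowerMass_nonneg B x]
  rw [steinEnvelope, div_le_iff₀ (mul_pos hZ (driftDensity_pos B x))]
  calc lowerMass B x * upperMass B x ≤ lowerMass B x * totalMass B :=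
        mul_le_mul_of_nonneg_left hT (lowerMass_nonneg B x)
    _ ≤ M * driftDensity B x * totalMass B := mul_le_mul_of_nonneg_right h hZ.le
    _ = _ := by ring

theorem steinEnvelope_le_of_upperMass_le {x M : ℝ} (h : upperMass B x ≤ M * driftDensity B x) :
    steinEnvelope B x ≤ M := by
  have hZ := totalMass_pos hν
  have hT : lowerMass B x ≤ totalMass B := by
    linarith [lowerMass_add_upperMass hν x, upperMass_nonneg B x]
  rw [steinEnvelope, div_le_iff₀ (mul_pos hZ (driftDensity_pos B x))]
  calc lowerMass B x * upperMass B x ≤ totalMass B * upperMass B x :=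
        mul_le_mul_of_nonneg_right hT (upperMass_nonneg B x)
    _ ≤ totalMass B * (M * driftDensity B x) := mul_le_mul_of_nonneg_left h hZ.le
    _ = _ := by ring

theorem abs_drift_mul_steinSolution_le (hB : Continuous B) (hanti : Antitone B) (a x : ℝ) :
    |B x * steinSolution B a x| ≤ 1 := by
  rw [abs_mul, abs_of_nonneg (steinSolution_nonneg hν a x)]
  refine (mul_le_mul_of_nonneg_left (steinSolution_le_envelope hν a x) (abs_nonneg _)).trans ?_
  rcases (abs_nonneg (B x)).eq_or_lt with h0 | h0
  · rw [← h0, zero_mul]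
    exact zero_le_one
  rw [mul_comm, ← le_div_iff₀ h0]
  rcases le_total 0 (B x) with h | h
  · refine steinEnvelope_le_of_lowerMass_le hν ?_
    rw [abs_of_nonneg h] at h0 ⊢
    rw [div_mul_eq_mul_div, one_mul, le_div_iff₀ h0, mul_comm]
    exact drift_mul_lowerMass_le hν hB hanti x
  · refine steinEnvelope_le_of_upperMass_le hν ?_
    rw [abs_of_nonpos h] at h0 ⊢
    rw [div_mul_eq_mul_div, one_mul, le_div_iff₀ h0, mul_comm]
    exact neg_drift_mul_upperMass_le hν hB hanti x

theorem abs_steinSlope_le (hB : Continuous B) (hanti : Antitone B) (a x : ℝ) :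
    |steinSlope B a x| ≤ 2 := by
  have h := abs_le.1 (abs_drift_mul_steinSolution_le hν hB hanti a x)
  have hZ := totalMass_pos hν
  have h0 : 0 ≤ lowerMass B a / totalMass B := div_nonneg (lowerMass_nonneg B a) hZ.le
  have h1 : lowerMass B a / totalMass B ≤ 1 := by
    rw [div_le_one hZ]
    linarith [lowerMass_add_upperMass hν a, upperMass_nonneg B a]
  rw [steinSlope, abs_le]
  -- One unit comes from the indicator minus a probability, one from the drift term.
  constructor <;> split_ifs <;> linarith [h.1, h.2]

theorem hasDerivWithinAt_steinSolution_Iic (hB : Continuous B) {x : ℝ} (hx : x ≤ a) :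
    HasDerivWithinAt (steinSolution B a) (steinSlope B a x) (Set.Iic a) x := by
  have h := (((hasDerivAt_lowerMass hν hB x).div (hasDerivAt_driftDensity hB x)
    (driftDensity_pos B x).ne').const_mul (upperMass B a / totalMass B)).hasDerivWithinAt
    (s := Set.Iic a)
  have hg := h.congr (fun y hy => steinSolution_of_le hy) (steinSolution_of_le hx)
  refine hg.congr_deriv ?_
  have hZ := (totalMass_pos hν).ne'
  have hpos := (driftDensity_pos B x).ne'
  rw [steinSlope, if_pos hx, steinSolution_of_le hx]
  have e : upperMass B a = totalMass B - lowerMass B a := by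
    linarith [lowerMass_add_upperMass hν a]
  rw [e]
  field_simp

theorem hasDerivWithinAt_steinSolution_Ici (hB : Continuous B) {x : ℝ} (hx : a < x) :
    HasDerivWithinAt (steinSolution B a) (steinSlope B a x) (Set.Ici a) x := by
  have h := (((hasDerivAt_upperMass hν hB x).div (hasDerivAt_driftDensity hB x)
    (driftDensity_pos B x).ne').const_mul (lowerMass B a / totalMass B)).hasDerivWithinAt
    (s := Set.Ici a)
  have hg := h.congr (fun y hy => steinSolution_of_ge hy) (steinSolution_of_ge hx.le)
  refine hg.congr_deriv ?_
  have hZ := (totalMass_pos hν).ne'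
  have hpos := (driftDensity_pos B x).ne'
  rw [steinSlope, if_neg hx.not_ge, steinSolution_of_ge hx.le]
  field_simp
  ring

theorem continuous_steinSolution (hB : Continuous B) (a : ℝ) :
    Continuous (steinSolution B a) := by
  have h1 : Continuous (lowerMass B) :=
    continuous_iff_continuousAt.2 fun x => (hasDerivAt_lowerMass hν hB x).continuousAt
  have h2 : Continuous (upperMass B) :=
    continuous_iff_continuousAt.2 fun x => (hasDerivAt_upperMass hν hB x).continuousAt
  exact ((h1.comp (continuous_id.min continuous_const)).mul
    (h2.comp (continuous_id.max continuous_const))).div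
    (continuous_const.mul (continuous_driftDensity hB))
    fun x => (mul_pos (totalMass_pos hν) (driftDensity_pos B x)).ne'

/-- Taylor estimate on an interval that does not contain the jump of the half-line indicator in
its interior. -/
theorem abs_steinSolution_taylor_le (hB : Continuous B) {x y K : ℝ} (hxy : x ≤ y)
    (hside : y ≤ a ∨ a < x)
    (hK : ∀ u ∈ Set.Icc x y, |steinSlope B a u - steinSlope B a x| ≤ K) :
    |steinSolution B a y - steinSolution B a x - (y - x) * steinSlope B a x| ≤ K * (y - x) := by
  have hd : ∀ u ∈ Set.Icc x y,
      HasDerivWithinAt (steinSolution B a) (steinSlope B a u) (Set.Icc x y) u := by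
    intro u hu
    rcases hside with h | h
    · exact (hasDerivWithinAt_steinSolution_Iic hν hB (hu.2.trans h)).mono
        fun v hv => hv.2.trans h
    · exact (hasDerivWithinAt_steinSolution_Ici hν hB (h.trans_le hu.1)).mono
        fun v hv => h.le.trans hv.1
  have hm := (convex_Icc x y).norm_image_sub_le_of_norm_hasDerivWithin_le
    (f := fun u => steinSolution B a u - u * steinSlope B a x)
    (f' := fun u => steinSlope B a u - 1 * steinSlope B a x) (C := K)
    (fun u hu => (hd u hu).sub ((hasDerivWithinAt_id u _).mul_const _))
    (fun u hu => by simpa using hK u hu) (Set.left_mem_Icc.2 hxy) (Set.right_mem_Icc.2 hxy)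
  rw [Real.norm_eq_abs, Real.norm_eq_abs, abs_of_nonneg (sub_nonneg.2 hxy)] at hm
  refine le_trans (le_of_eq ?_) hm
  congr 1
  ring

theorem abs_steinSolution_sub_le (hB : Continuous B) (hanti : Antitone B) {x y : ℝ}
    (hxy : x ≤ y) : |steinSolution B a y - steinSolution B a x| ≤ 2 * (y - x) := by
  have hb := fun u => abs_steinSlope_le hν hB hanti a u
  have hleft : ∀ {x y : ℝ}, x ≤ y → y ≤ a →
      |steinSolution B a y - steinSolution B a x| ≤ 2 * (y - x) := by
    intro x y hxy hy
    have h := (convex_Icc x y).norm_image_sub_le_of_norm_hasDerivWithin_le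
      (fun u hu => (hasDerivWithinAt_steinSolution_Iic hν hB (hu.2.trans hy)).mono
        (fun v hv => hv.2.trans hy)) (fun u _ => hb u)
      (Set.left_mem_Icc.2 hxy) (Set.right_mem_Icc.2 hxy)
    rwa [Real.norm_eq_abs, Real.norm_eq_abs, abs_of_nonneg (sub_nonneg.2 hxy)] at h
  have hright' : ∀ {x y : ℝ}, x ≤ y → a < x →
      |steinSolution B a y - steinSolution B a x| ≤ 2 * (y - x) := by
    intro x y hxy hx
    have h := (convex_Icc x y).norm_image_sub_le_of_norm_hasDerivWithin_le
      (fun u hu => (hasDerivWithinAt_steinSolution_Ici hν hB (hx.trans_le hu.1)).mono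
        (fun v hv => hx.le.trans hv.1)) (fun u _ => hb u)
      (Set.left_mem_Icc.2 hxy) (Set.right_mem_Icc.2 hxy)
    rwa [Real.norm_eq_abs, Real.norm_eq_abs, abs_of_nonneg (sub_nonneg.2 hxy)] at h
  have hright : ∀ {y : ℝ}, a ≤ y →
      |steinSolution B a y - steinSolution B a a| ≤ 2 * (y - a) := by
    intro y hy
    rcases hy.eq_or_lt with rfl | hlt
    · simp
    -- At `a` itself `steinSlope` takes the left derivative, so the estimate on the right is
    -- obtained by letting the left endpoint decrease to `a`.
    have hc := continuous_steinSolution hν hB a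
    have h1 : Tendsto (fun x => |steinSolution B a y - steinSolution B a x|) (𝓝[>] a)
        (𝓝 |steinSolution B a y - steinSolution B a a|) :=
      ((continuous_const.sub hc).abs.tendsto a).mono_left nhdsWithin_le_nhds
    have h2 : Tendsto (fun x => 2 * (y - x)) (𝓝[>] a) (𝓝 (2 * (y - a))) :=
      ((by fun_prop : Continuous fun x : ℝ => 2 * (y - x)).tendsto a).mono_left nhdsWithin_le_nhds
    refine le_of_tendsto_of_tendsto h1 h2 ?_
    filter_upwards [Ioc_mem_nhdsGT hlt] with x hx
    exact hright' hx.2 hx.1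
  rcases le_total y a with hy | hy
  · exact hleft hxy hy
  rcases lt_or_ge a x with hx | hx
  · exact hright' hxy hx
  · have h1 := hleft hx le_rfl
    have h2 := hright hy
    have h3 := abs_sub_le (steinSolution B a y) (steinSolution B a a) (steinSolution B a x)
    linarith

/-- The error in replacing a difference quotient of the Stein solution by its derivative. -/
theorem abs_stein_error_le (hB : Continuous B) (hanti : Antitone B) {L : ℝ}
    (hL : ∀ x y : ℝ, x ≤ y → y ≤ x + 1 → (B x - B y) * steinSolution B a y ≤ L * (y - x))
    (hL0 : 0 ≤ L) {x δ : ℝ} (hδ : 0 ≤ δ) (hδ1 : δ ≤ 1) (hside : x + δ ≤ a ∨ a < x) :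
    |steinSolution B a (x + δ) - steinSolution B a x - δ * steinSlope B a x| ≤
      δ ^ 2 * (2 * |B x| + L) := by
  have h := abs_steinSolution_taylor_le hν hB (a := a) (x := x) (y := x + δ)
    (K := δ * (2 * |B x| + L)) (by linarith) hside ?_
  · rw [add_sub_cancel_left] at h
    exact h.trans_eq (by ring)
  intro u hu
  have hif : (if u ≤ a then (1 : ℝ) else 0) = if x ≤ a then 1 else 0 := by
    rcases hside with h | h
    · rw [if_pos (hu.2.trans h), if_pos (by linarith)]
    · rw [if_neg (by linarith [hu.1]), if_neg (by linarith)]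
  -- The indicators cancel. What remains is a discrete product rule for `B g`, which avoids
  -- differentiating `B` at its kink.
  have e : steinSlope B a u - steinSlope B a x =
      (B x - B u) * steinSolution B a u - B x * (steinSolution B a u - steinSolution B a x) := by
    rw [steinSlope, steinSlope, hif]
    ring
  have hux : u - x ≤ δ := by linarith [hu.2]
  have hux0 : 0 ≤ u - x := by linarith [hu.1]
  have h1 : |(B x - B u) * steinSolution B a u| ≤ L * δ := by
    rw [abs_of_nonneg (mul_nonneg (sub_nonneg.2 (hanti hu.1)) (steinSolution_nonneg hν a u))]
    exact (hL x u hu.1 (by linarith [hu.2])).trans (mul_le_mul_of_nonneg_left hux hL0)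
  have h2 : |B x * (steinSolution B a u - steinSolution B a x)| ≤ |B x| * (2 * δ) := by
    rw [abs_mul]
    refine mul_le_mul_of_nonneg_left ?_ (abs_nonneg _)
    exact (abs_steinSolution_sub_le hν hB hanti hu.1).trans (by linarith)
  rw [e]
  refine (abs_sub _ _).trans ?_
  linarith

theorem abs_stein_error_le_four (hB : Continuous B) (hanti : Antitone B) {x δ : ℝ} (hδ : 0 ≤ δ) :
    |steinSolution B a (x + δ) - steinSolution B a x - δ * steinSlope B a x| ≤ 4 * δ := by
  have h1 := abs_steinSolution_sub_le hν hB hanti (a := a) (x := x) (y := x + δ) (by linarith)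
  have h2 := mul_le_mul_of_nonneg_left (abs_steinSlope_le hν hB hanti a x) hδ
  rw [add_sub_cancel_left] at h1
  refine (abs_sub _ _).trans ?_
  rw [abs_mul, abs_of_nonneg hδ]
  linarith

end Stein

/-! ### Piecewise linear drift -/

section PiecewiseDrift

/-- The continuous drift vanishing at `0` with slope `-1` on `(-∞, κ]` and slope `-c` on
`[κ, ∞)`. -/
def piecewiseDrift (c κ x : ℝ) : ℝ := min 0 κ - min x κ - c * (max x κ - max 0 κ)

variable {c κ : ℝ}

@[simp] theorem piecewiseDrift_zero (c κ : ℝ) : piecewiseDrift c κ 0 = 0 := by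
  simp [piecewiseDrift]

theorem continuous_piecewiseDrift (c κ : ℝ) : Continuous (piecewiseDrift c κ) := by
  unfold piecewiseDrift
  fun_prop

theorem piecewiseDrift_sub (c κ x y : ℝ) :
    piecewiseDrift c κ x - piecewiseDrift c κ y =
      (min y κ - min x κ) + c * (max y κ - max x κ) := by
  unfold piecewiseDrift
  ring

theorem min_mul_le_piecewiseDrift_sub (c κ : ℝ) {x y : ℝ} (hxy : x ≤ y) :
    min 1 c * (y - x) ≤ piecewiseDrift c κ x - piecewiseDrift c κ y := by
  have h1 : 0 ≤ min y κ - min x κ := sub_nonneg.2 (min_le_min_right _ hxy)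
  have h2 : 0 ≤ max y κ - max x κ := sub_nonneg.2 (max_le_max_right _ hxy)
  have h3 : y - x = (min y κ - min x κ) + (max y κ - max x κ) := by
    linarith [min_add_max y κ, min_add_max x κ]
  rw [piecewiseDrift_sub, h3]
  nlinarith [mul_le_mul_of_nonneg_right (min_le_left 1 c) h1,
    mul_le_mul_of_nonneg_right (min_le_right 1 c) h2]

theorem antitone_piecewiseDrift (hc : 0 < c) (κ : ℝ) : Antitone (piecewiseDrift c κ) := by
  intro x y hxy
  have h1 := min_mul_le_piecewiseDrift_sub c κ hxy
  have h2 : 0 ≤ min 1 c * (y - x) :=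
    mul_nonneg (le_min zero_le_one hc.le) (sub_nonneg.2 hxy)
  linarith

theorem integrable_driftDensity_piecewiseDrift (hc : 0 < c) (κ : ℝ) :
    Integrable (driftDensity (piecewiseDrift c κ)) := by
  refine integrable_driftDensity (continuous_piecewiseDrift c κ) (lt_min one_pos hc)
    (fun x hx => ?_) (fun x hx => ?_)
  · have := min_mul_le_piecewiseDrift_sub c κ hx
    rw [piecewiseDrift_zero] at this
    linarith
  · have := min_mul_le_piecewiseDrift_sub c κ hx
    rw [piecewiseDrift_zero] at this
    linarith

/-- The bound must not depend on `c` or `κ`. For `x ≤ 0` the slope `-1` controls the lower tail, and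
for `0 ≤ x ≤ κ` with `κ ≥ 1` the drift at `x + 1` is at most `-1` and controls the upper tail. If `κ
< 1`, the upper tail may be heavy for small `c`; instead the lower mass is at most `3` and the
density at `x` at least `1/3`, whence `9`. -/
theorem steinEnvelope_le_of_le (hc : 0 < c) {x : ℝ} (hx : x ≤ κ) :
    steinEnvelope (piecewiseDrift c κ) x ≤ 9 := by
  have hB := continuous_piecewiseDrift c κ
  have hanti := antitone_piecewiseDrift hc κ
  have hν := integrable_driftDensity_piecewiseDrift hc κ
  have hB1 : ∀ y ≤ κ, piecewiseDrift c κ (y - 1) = piecewiseDrift c κ y + 1 := by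
    intro y hy
    have := piecewiseDrift_sub c κ (y - 1) y
    rw [min_eq_left hy, min_eq_left (by linarith), max_eq_right hy,
      max_eq_right (by linarith)] at this
    linarith
  have hlow : ∀ y ≤ κ, y ≤ 0 → lowerMass (piecewiseDrift c κ) y ≤
      2 * driftDensity (piecewiseDrift c κ) y := by
    intro y hy hy0
    have h0 : 0 ≤ piecewiseDrift c κ y := by simpa using hanti hy0
    have h := lowerMass_le_of_le_one hν hB hanti h0 one_pos (by rw [hB1 y hy]; linarith)
    linarith
  rcases le_total x 0 with hx0 | hx0
  · linarith [steinEnvelope_le_of_lowerMass_le hν (hlow x hx hx0)]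
  have hBx : ∀ u, 0 ≤ u → u ≤ κ → piecewiseDrift c κ u = -u := by
    intro u hu huκ
    rw [piecewiseDrift, min_eq_left (hu.trans huκ), min_eq_left huκ, max_eq_right huκ,
      max_eq_right (hu.trans huκ)]
    ring
  rcases le_total 1 κ with hκ | hκ
  · have h1 : piecewiseDrift c κ (x + 1) ≤ -1 := by
      have h := hanti (by linarith : (1 : ℝ) ≤ x + 1)
      rwa [hBx 1 zero_le_one hκ] at h
    have h := upperMass_le_of_le_one hν hB hanti (by simpa using hanti hx0) one_pos
      (by linarith)
    linarith [steinEnvelope_le_of_upperMass_le hν h]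
  · have hν1 : ∀ u ∈ Set.Icc 0 x, driftDensity (piecewiseDrift c κ) u ≤ 1 := by
      intro u hu
      rw [← driftDensity_zero (piecewiseDrift c κ)]
      exact driftDensity_anti_of_nonpos hB hu.1 fun v hv => by simpa using hanti hv.1
    have hF : lowerMass (piecewiseDrift c κ) x ≤ 3 := by
      have h0 := hlow 0 (hx0.trans hx) le_rfl
      have h1 := lowerMass_sub hν 0 x
      have h2 := intervalIntegral.integral_mono_on hx0
        ((continuous_driftDensity hB).intervalIntegrable _ _)
        (continuous_const.intervalIntegrable (μ := volume) _ _) hν1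
      simp only [intervalIntegral.integral_const, smul_eq_mul, driftDensity_zero] at h0 h2
      linarith
    have hνx : 1 / 3 ≤ driftDensity (piecewiseDrift c κ) x := by
      have h1 : -1 ≤ ∫ y in (0 : ℝ)..x, piecewiseDrift c κ y := by
        have h2 := intervalIntegral.integral_mono_on hx0
          (continuous_const.intervalIntegrable (μ := volume) _ _)
          (hB.intervalIntegrable _ _) (f := fun _ => (-1 : ℝ))
          fun u hu => by rw [hBx u hu.1 (hu.2.trans hx)]; linarith [hu.2]
        simp only [intervalIntegral.integral_const, smul_eq_mul] at h2
        linarith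
      have h2 : (1 : ℝ) / 3 ≤ Real.exp (-1) := by
        rw [Real.exp_neg, one_div]
        exact inv_anti₀ (Real.exp_pos 1) (Real.exp_one_lt_d9.le.trans (by norm_num))
      exact h2.trans (Real.exp_le_exp.2 h1)
    exact steinEnvelope_le_of_lowerMass_le hν (by linarith)

/-- The factor `c` absorbs the `1 / c` in the tail estimate where the restoring slope is only `-c`.
-/
theorem mul_steinEnvelope_le_of_ge (hc : 0 < c) {x : ℝ} (hx : κ ≤ x) :
    c * steinEnvelope (piecewiseDrift c κ) x ≤ 2 * c + 1 := by
  have hB := continuous_piecewiseDrift c κ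
  have hanti := antitone_piecewiseDrift hc κ
  have hν := integrable_driftDensity_piecewiseDrift hc κ
  rcases le_total 0 x with hx0 | hx0
  · have h0 : piecewiseDrift c κ x ≤ 0 := by simpa using hanti hx0
    have h1 := piecewiseDrift_sub c κ x (x + 1)
    rw [min_eq_right hx, min_eq_right (by linarith), max_eq_left hx,
      max_eq_left (by linarith)] at h1
    have h := steinEnvelope_le_of_upperMass_le hν
      (upperMass_le_of_le_one hν hB hanti h0 hc (by linarith))
    calc c * steinEnvelope (piecewiseDrift c κ) x ≤ c * (1 + 1 / c) :=
          mul_le_mul_of_nonneg_left h hc.le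
      _ = c + 1 := by field_simp
      _ ≤ 2 * c + 1 := by linarith
  · have h0 : 0 ≤ piecewiseDrift c κ x := by simpa using hanti hx0
    have hm : 0 < min 1 c := lt_min one_pos hc
    have h1 := min_mul_le_piecewiseDrift_sub c κ (by linarith : x - 1 ≤ x)
    have h := steinEnvelope_le_of_lowerMass_le hν
      (lowerMass_le_of_le_one hν hB hanti h0 hm (by linarith))
    have h2 : c * (1 / min 1 c) ≤ c + 1 := by
      rw [mul_one_div, div_le_iff₀ hm]
      rcases min_cases 1 c with ⟨h, -⟩ | ⟨h, -⟩ <;> rw [h] <;> nlinarith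
    have h3 := mul_le_mul_of_nonneg_left h hc.le
    linarith

/-- The interval is split at `κ`: the left part has slope `-1` and meets a bounded solution, the
right part has slope `-c` and meets the bound on `c` times the solution. -/
theorem piecewiseDrift_sub_mul_steinSolution_le (hc : 0 < c) (a : ℝ) {x y : ℝ} (hxy : x ≤ y)
    (hy1 : y ≤ x + 1) :
    (piecewiseDrift c κ x - piecewiseDrift c κ y) * steinSolution (piecewiseDrift c κ) a y ≤
      (12 + 2 * c) * (y - x) := by
  have hB := continuous_piecewiseDrift c κ
  have hanti := antitone_piecewiseDrift hc κ
  have hν := integrable_driftDensity_piecewiseDrift hc κ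
  set g := steinSolution (piecewiseDrift c κ) a
  have hg0 : 0 ≤ g y := steinSolution_nonneg hν a y
  have hle : ∀ u, g u ≤ steinEnvelope (piecewiseDrift c κ) u := steinSolution_le_envelope hν a
  have hm : 0 ≤ min y κ - min x κ := sub_nonneg.2 (min_le_min_right _ hxy)
  have hM : 0 ≤ max y κ - max x κ := sub_nonneg.2 (max_le_max_right _ hxy)
  have hsum : y - x = (min y κ - min x κ) + (max y κ - max x κ) := by
    linarith [min_add_max y κ, min_add_max x κ]
  -- If `κ` lies between `x` and `y`, then `g y` exceeds `g κ ≤ 9` by at most `2 (y - κ) ≤ 2`, hence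
  -- `11`.
  have h1 : (min y κ - min x κ) * g y ≤ (min y κ - min x κ) * 11 := by
    rcases le_total y κ with hy | hy
    · exact mul_le_mul_of_nonneg_left
        (by linarith [hle y, steinEnvelope_le_of_le hc hy]) hm
    rcases le_total κ x with hx | hx
    · rw [min_eq_right hy, min_eq_right hx, sub_self, zero_mul, zero_mul]
    · refine mul_le_mul_of_nonneg_left ?_ hm
      have h := (abs_le.1 (abs_steinSolution_sub_le hν hB hanti (a := a) hy)).2
      linarith [hle κ, steinEnvelope_le_of_le hc (le_refl κ)]
  have h2 : (max y κ - max x κ) * (c * g y) ≤ (max y κ - max x κ) * (2 * c + 1) := by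
    rcases le_total κ y with hy | hy
    · exact mul_le_mul_of_nonneg_left ((mul_le_mul_of_nonneg_left (hle y) hc.le).trans
        (mul_steinEnvelope_le_of_ge hc hy)) hM
    · rw [max_eq_right hy, max_eq_right (hxy.trans hy), sub_self, zero_mul, zero_mul]
  rw [piecewiseDrift_sub, hsum]
  nlinarith [mul_nonneg hm hc.le, mul_nonneg hM hc.le]

end PiecewiseDrift

/-! ### Reduction to service rate one -/

section Scaling

variable {n : ℕ} {lam μ α : ℝ}

theorem fluidEquilibrium_div (hμ : 0 < μ) :
    fluidEquilibrium n (lam / μ) 1 (α / μ) = fluidEquilibrium n lam μ α := by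
  simp only [fluidEquilibrium, offeredLoad, div_one, mul_one]
  congr 2
  field_simp

theorem departureRate_div (hμ : 0 < μ) (k : ℕ) :
    departureRate n 1 (α / μ) k = departureRate n μ α k / μ := by
  simp only [departureRate]
  field_simp

theorem one_div_mul_drift (hμ : 0 < μ) (x : ℝ) :
    1 / μ * drift n lam μ α x = piecewiseDrift (α / μ) (-zeta n lam μ α) x := by
  set z := zeta n lam μ α with hz
  have h1 : max (-(x + z)) 0 = -z - min x (-z) := by
    rw [max_def, min_def]; split_ifs <;> linarith
  have h2 : max (x + z) 0 = max x (-z) + z := by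
    rw [max_def, max_def]; split_ifs <;> linarith
  have h3 : max (-z) 0 = -z - min 0 (-z) := by
    rw [max_def, min_def]; split_ifs <;> linarith
  have h4 : max z 0 = max 0 (-z) + z := by
    rw [max_def, max_def]; split_ifs <;> linarith
  simp only [drift, piecewiseDrift, ← hz]
  rw [h1, h2, h3, h4]
  field_simp
  ring

theorem unnormalizedDensity_eq (hμ : 0 < μ) :
    unnormalizedDensity n lam μ α =
      driftDensity (piecewiseDrift (α / μ) (-zeta n lam μ α)) := by
  funext x
  rw [unnormalizedDensity, driftDensity, ← intervalIntegral.integral_const_mul]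
  simp only [one_div_mul_drift hμ]

theorem diffusionLaw_real_Iic (hμ : 0 < μ) (hα : 0 < α) (a : ℝ) :
    (diffusionLaw n lam μ α).real (Set.Iic a) =
      lowerMass (piecewiseDrift (α / μ) (-zeta n lam μ α)) a /
        totalMass (piecewiseDrift (α / μ) (-zeta n lam μ α)) := by
  set B := piecewiseDrift (α / μ) (-zeta n lam μ α)
  have hν : Integrable (driftDensity B) :=
    integrable_driftDensity_piecewiseDrift (div_pos hα hμ) _
  have hZ := totalMass_pos hν
  rw [diffusionLaw, unnormalizedDensity_eq hμ, Measure.real, withDensity_apply _ measurableSet_Iic]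
  change (∫⁻ x in Set.Iic a, ENNReal.ofReal ((totalMass B)⁻¹ * driftDensity B x)).toReal = _
  rw [← ofReal_integral_eq_lintegral_ofReal (hν.const_mul _).integrableOn
      (Eventually.of_forall fun x => mul_nonneg (inv_nonneg.2 hZ.le) (driftDensity_pos B x).le),
    integral_const_mul]
  change (ENNReal.ofReal ((totalMass B)⁻¹ * lowerMass B a)).toReal = _
  rw [ENNReal.toReal_ofReal (mul_nonneg (inv_nonneg.2 hZ.le) (lowerMass_nonneg B a)),
    inv_mul_eq_div]

end Scaling

/-! ### The Kolmogorov bound -/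

section Kolmogorov

variable {n : ℕ} {R c : ℝ}

/-- The scaled position `(k - x(∞)) / √R` of state `k`, for service rate one. -/
def scaledState (n : ℕ) (R c : ℝ) (k : ℕ) : ℝ := ((k : ℝ) - fluidEquilibrium n R 1 c) / √R

theorem scaledState_succ (n : ℕ) (R c : ℝ) (k : ℕ) :
    scaledState n R c (k + 1) = scaledState n R c k + 1 / √R := by
  simp only [scaledState]
  push_cast
  ring

/-- The rescaled net drift of the chain is the drift of the diffusion. -/
theorem piecewiseDrift_scaledState (hR : 0 < R) (hc : 0 < c) (k : ℕ) :
    piecewiseDrift c (-zeta n R 1 c) (scaledState n R c k) =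
      (R - departureRate n 1 c k) / √R := by
  have hs : 0 < √R := Real.sqrt_pos.2 hR
  have hfl := (flowBalance_iff n (lam := R) one_pos hc _).2 rfl
  set x := fluidEquilibrium n R 1 c with hx
  have hκ : -zeta n R 1 c = (n - x) / √R := by
    simp only [zeta, offeredLoad, div_one, ← hx]
    ring
  have h0 : (0 : ℝ) = (x - x) / √R := by simp
  have hmin : ∀ y : ℝ, min ((y - x) / √R) ((n - x) / √R) = (min y n - x) / √R := by
    intro y
    rw [min_div_div_right hs.le, min_sub_sub_right]
  have hmax : ∀ y : ℝ, max ((y - x) / √R) ((n - x) / √R) = (max y n - x) / √R := by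
    intro y
    rw [max_div_div_right hs.le, max_sub_sub_right]
  have hM : ∀ y : ℝ, max (y - n) 0 = max y n - n := by
    intro y
    rw [← max_sub_sub_right, sub_self]
  rw [piecewiseDrift, scaledState, ← hx, hκ, h0, hmin, hmax, hmin, hmax]
  rw [hM] at hfl
  have hdiff : R - departureRate n 1 c k =
      (min x n - min (k : ℝ) n) + c * (max x n - max (k : ℝ) n) := by
    rw [departureRate, hM]
    linarith
  rw [hdiff]
  ring

theorem departureRate_nonneg {μ α : ℝ} (hμ : 0 ≤ μ) (hα : 0 ≤ α) (k : ℕ) :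
    0 ≤ departureRate n μ α k := by
  unfold departureRate
  positivity

theorem departureRate_zero (n : ℕ) (μ α : ℝ) : departureRate n μ α 0 = 0 := by
  simp [departureRate]

theorem departureRate_succ_le (hc : 0 ≤ c) (k : ℕ) :
    departureRate n 1 c (k + 1) ≤ departureRate n 1 c k + (1 + c) := by
  simp only [departureRate, mul_one]
  push_cast
  have h1 : min ((k : ℝ) + 1) n ≤ min (k : ℝ) n + 1 := by
    rw [min_def, min_def]; split_ifs <;> linarith
  have h2 : max ((k : ℝ) + 1 - n) 0 ≤ max ((k : ℝ) - n) 0 + 1 := by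
    rw [max_def, max_def]; split_ifs <;> linarith
  nlinarith [mul_le_mul_of_nonneg_right h2 hc]

variable {p : ℕ → ℝ}

/-- At most one lattice point lies within one lattice step to the left of `a`. -/
theorem sum_range_straddling_le (hR : 0 < R) {P : ℝ} (hP0 : 0 ≤ P) (hP : ∀ k, p k ≤ P)
    (a : ℝ) (N : ℕ) :
    ∑ k ∈ Finset.range N, (if scaledState n R c k ≤ a ∧ a < scaledState n R c k + 1 / √R
      then p k else 0) ≤ P := by
  have hs : 0 < √R := Real.sqrt_pos.2 hR
  have hle : ∀ i j : ℕ, scaledState n R c i ≤ a → a < scaledState n R c j + 1 / √R → i ≤ j := by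
    intro i j hi hj
    by_contra! hlt
    have h1 : scaledState n R c (j + 1) ≤ scaledState n R c i := by
      refine div_le_div_of_nonneg_right (sub_le_sub_right ?_ _) hs.le
      exact_mod_cast hlt
    rw [scaledState_succ] at h1
    linarith
  rw [← Finset.sum_filter]
  refine (Finset.sum_le_card_nsmul _ _ P fun k _ => hP k).trans ?_
  rw [nsmul_eq_mul]
  refine mul_le_of_le_one_left hP0 ?_
  exact_mod_cast Finset.card_le_one.2 fun i hi j hj => by
    rw [Finset.mem_filter] at hi hj
    exact le_antisymm (hle i j hi.2.1 hj.2.2) (hle j i hj.2.1 hi.2.2)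

/-- The constant in the Kolmogorov bound as a function of `c = α / μ`. -/
def kolmogorovConstant (c : ℝ) : ℝ := 2 * (2 + c) + (12 + 2 * c) + 4 * Real.exp (1 + c)

/-- The three summands of `kolmogorovConstant` come from the mean of `1 + B^2`, from the increments
of `B` times the solution, and from the one cell straddling `a`. -/
theorem sum_range_abs_stein_error_le (hR : 1 ≤ R) (hc : 0 < c)
    (hp : ∀ k, 0 ≤ p k) (hsum : HasSum p 1)
    (hbal : ∀ k, R * p k = departureRate n 1 c (k + 1) * p (k + 1)) (a : ℝ) (N : ℕ) :
    ∑ k ∈ Finset.range N, p k *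
      |√R * (steinSolution (piecewiseDrift c (-zeta n R 1 c)) a (scaledState n R c (k + 1)) -
        steinSolution (piecewiseDrift c (-zeta n R 1 c)) a (scaledState n R c k)) -
        steinSlope (piecewiseDrift c (-zeta n R 1 c)) a (scaledState n R c k)| ≤
      kolmogorovConstant c / √R := by
  have hR0 : 0 < R := by linarith
  have hs : 0 < √R := Real.sqrt_pos.2 hR0
  have hsq : √R ^ 2 = R := Real.sq_sqrt hR0.le
  set B := piecewiseDrift c (-zeta n R 1 c) with hBdef
  have hB : Continuous B := continuous_piecewiseDrift _ _
  have hanti : Antitone B := antitone_piecewiseDrift hc _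
  have hν : Integrable (driftDensity B) := integrable_driftDensity_piecewiseDrift hc _
  have hδ0 : 0 ≤ 1 / √R := by positivity
  have hδ1 : 1 / √R ≤ 1 := (div_le_one hs).2 (Real.one_le_sqrt.2 hR)
  have hD0 := departureRate_zero n 1 c
  have hDn : ∀ k, 0 ≤ departureRate n 1 c k := departureRate_nonneg zero_le_one hc.le
  have hstep := fun k => departureRate_succ_le (n := n) hc.le k
  have hA : 0 ≤ 1 + c := by linarith
  have hscale : ∀ k, √R * (steinSolution B a (scaledState n R c (k + 1)) -
      steinSolution B a (scaledState n R c k)) - steinSlope B a (scaledState n R c k) =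
      √R * (steinSolution B a (scaledState n R c k + 1 / √R) -
        steinSolution B a (scaledState n R c k) -
          1 / √R * steinSlope B a (scaledState n R c k)) := by
    intro k
    rw [scaledState_succ]
    field_simp
  have hterm : ∀ k, p k * |√R * (steinSolution B a (scaledState n R c (k + 1)) -
      steinSolution B a (scaledState n R c k)) - steinSlope B a (scaledState n R c k)| ≤
      (2 * (p k + p k * (R - departureRate n 1 c k) ^ 2 / R) + (12 + 2 * c) * p k) / √R +
      4 * (if scaledState n R c k ≤ a ∧ a < scaledState n R c k + 1 / √R then p k else 0) := by
    intro k
    rw [hscale, abs_mul, abs_of_pos hs]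
    have hfirst : 0 ≤ (2 * (p k + p k * (R - departureRate n 1 c k) ^ 2 / R) +
        (12 + 2 * c) * p k) / √R := by
      have := hp k
      positivity
    split_ifs with hst
    · have h := mul_le_mul_of_nonneg_left (abs_stein_error_le_four hν hB hanti (a := a)
        (x := scaledState n R c k) hδ0) (mul_nonneg (hp k) hs.le)
      have e : p k * √R * (4 * (1 / √R)) = 4 * p k := by field_simp
      rw [e, mul_assoc] at h
      linarith
    · have hside : scaledState n R c k + 1 / √R ≤ a ∨ a < scaledState n R c k := by
        by_contra! hcon
        exact hst ⟨hcon.2, hcon.1⟩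
      have h := mul_le_mul_of_nonneg_left (abs_stein_error_le hν hB hanti
        (fun x y => piecewiseDrift_sub_mul_steinSolution_le hc a) (by linarith) hδ0 hδ1 hside)
        (mul_nonneg (hp k) hs.le)
      rw [mul_assoc] at h
      rw [mul_zero, add_zero]
      refine h.trans ?_
      -- Passing from `|B|` to `1 + B^2` lets the second moment bound apply.
      have hb : |B (scaledState n R c k)| ≤ 1 + (R - departureRate n 1 c k) ^ 2 / R := by
        have e : B (scaledState n R c k) ^ 2 = (R - departureRate n 1 c k) ^ 2 / R := by
          rw [hBdef, piecewiseDrift_scaledState hR0 hc, div_pow, hsq]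
        rw [← e, ← sq_abs]
        nlinarith [sq_nonneg (|B (scaledState n R c k)| - 1)]
      have e : p k * √R * ((1 / √R) ^ 2 * (2 * |B (scaledState n R c k)| + (12 + 2 * c))) =
          p k * (2 * |B (scaledState n R c k)| + (12 + 2 * c)) / √R := by field_simp
      rw [e]
      refine div_le_div_of_nonneg_right ?_ hs.le
      calc p k * (2 * |B (scaledState n R c k)| + (12 + 2 * c))
          ≤ p k * (2 * (1 + (R - departureRate n 1 c k) ^ 2 / R) + (12 + 2 * c)) :=
            mul_le_mul_of_nonneg_left (by linarith) (hp k)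
        _ = _ := by ring
  refine (Finset.sum_le_sum fun k _ => hterm k).trans ?_
  rw [Finset.sum_add_distrib, ← Finset.mul_sum, ← Finset.sum_div, Finset.sum_add_distrib,
    ← Finset.mul_sum, ← Finset.mul_sum, Finset.sum_add_distrib, ← Finset.sum_div]
  have h1 := sum_range_le_one hp hsum N
  have h2 : (∑ k ∈ Finset.range N, p k * (R - departureRate n 1 c k) ^ 2) / R ≤ 1 + c := by
    rw [div_le_iff₀ hR0, mul_comm]
    exact sum_range_mul_sq_le hbal hD0 hDn hstep hp hsum hR0.le hA N
  have h3 := sum_range_straddling_le (n := n) (c := c) hR0 (P := Real.exp (1 + c) / √R)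
    (by positivity)
    (fun k => (le_div_iff₀ hs).2 (mul_sqrt_le_exp hbal hD0 hstep hp hsum hR hA k)) a N
  have h4 : (2 * (∑ k ∈ Finset.range N, p k +
      (∑ k ∈ Finset.range N, p k * (R - departureRate n 1 c k) ^ 2) / R) +
      (12 + 2 * c) * ∑ k ∈ Finset.range N, p k) / √R ≤
      (2 * (2 + c) + (12 + 2 * c)) / √R := by
    refine div_le_div_of_nonneg_right ?_ hs.le
    nlinarith
  rw [kolmogorovConstant, add_div (2 * (2 + c) + (12 + 2 * c)), mul_div_assoc 4]
  linarith

theorem abs_tail_sub_le (hR : 1 ≤ R) (hc : 0 < c) (hp : ∀ k, 0 ≤ p k) (hsum : HasSum p 1)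
    (hbal : ∀ k, R * p k = departureRate n 1 c (k + 1) * p (k + 1)) (a : ℝ) {q : ℝ}
    (hq : HasSum (fun k => p k * if scaledState n R c k ≤ a then 1 else 0) q) :
    |q - lowerMass (piecewiseDrift c (-zeta n R 1 c)) a /
      totalMass (piecewiseDrift c (-zeta n R 1 c))| ≤ kolmogorovConstant c / √R := by
  have hR0 : 0 < R := by linarith
  have hs : 0 < √R := Real.sqrt_pos.2 hR0
  have hsq : √R * √R = R := Real.mul_self_sqrt hR0.le
  have herr := sum_range_abs_stein_error_le hR hc hp hsum hbal a
  set B := piecewiseDrift c (-zeta n R 1 c) with hBdef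
  set F := lowerMass B a / totalMass B with hF
  have hν : Integrable (driftDensity B) := integrable_driftDensity_piecewiseDrift hc _
  set g := fun k => steinSolution B a (scaledState n R c k) with hg
  -- This bound degenerates as `c → 0`, harmlessly: it only multiplies the boundary term, which
  -- vanishes in the limit.
  have hgbound : ∃ M, ∀ k, |g k| ≤ M := by
    refine ⟨9 + (2 * c + 1) / c, fun k => ?_⟩
    have h0 : 0 ≤ g k := steinSolution_nonneg hν a _
    have h1 : g k ≤ _ := steinSolution_le_envelope hν a _
    have h2 : 0 ≤ (2 * c + 1) / c := by positivity
    rw [abs_of_nonneg h0]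
    rcases le_total (scaledState n R c k) (-zeta n R 1 c) with h | h
    · linarith [steinEnvelope_le_of_le hc h]
    · have h3 := mul_steinEnvelope_le_of_ge hc h
      rw [mul_comm, ← le_div_iff₀ hc] at h3
      linarith
  obtain ⟨M, hM⟩ := hgbound
  -- The Stein equation summed against `p`, with `sum_range_generator` applied to `g` and divided by
  -- `√R`.
  have hident : ∀ N, ∑ k ∈ Finset.range (N + 1),
      (p k * (if scaledState n R c k ≤ a then 1 else 0) - F * p k) =
      √R * p N * g (N + 1) - ∑ k ∈ Finset.range (N + 1),
        p k * (√R * (g (k + 1) - g k) - steinSlope B a (scaledState n R c k)) := by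
    intro N
    have h := sum_range_generator hbal (departureRate_zero n 1 c) g (N + 1)
    rw [← hbal N] at h
    have h' : √R * p N * g (N + 1) = ∑ k ∈ Finset.range (N + 1),
        p k * (R * g (k + 1) - departureRate n 1 c k * g k) / √R := by
      rw [← Finset.sum_div, h]
      nth_rewrite 2 [← hsq]
      field_simp
    rw [h', ← Finset.sum_sub_distrib]
    refine Finset.sum_congr rfl fun k _ => ?_
    rw [steinSlope, ← hF, hBdef, piecewiseDrift_scaledState hR0 hc, ← hBdef]
    change _ = p k * (R * g (k + 1) - departureRate n 1 c k * g k) / √R - p k *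
      (√R * (g (k + 1) - g k) - ((if scaledState n R c k ≤ a then 1 else 0) - F -
        (R - departureRate n 1 c k) / √R * g k))
    have e : R / √R = √R := by rw [div_eq_iff hs.ne', hsq]
    have e1 : p k * (R * g (k + 1) - departureRate n 1 c k * g k) / √R =
        p k * (√R * g (k + 1) - departureRate n 1 c k / √R * g k) := by
      nth_rewrite 2 [← e]
      ring
    rw [e1, sub_div, e]
    ring
  have hbound : ∀ N, |∑ k ∈ Finset.range (N + 1),
      (p k * (if scaledState n R c k ≤ a then 1 else 0) - F * p k)| ≤
      √R * M * p N + kolmogorovConstant c / √R := by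
    intro N
    rw [hident]
    refine (abs_sub _ _).trans (add_le_add ?_ ?_)
    · rw [abs_mul, abs_of_nonneg (mul_nonneg hs.le (hp N))]
      calc √R * p N * |g (N + 1)| ≤ √R * p N * M :=
            mul_le_mul_of_nonneg_left (hM _) (mul_nonneg hs.le (hp N))
        _ = _ := by ring
    · refine (Finset.abs_sum_le_sum_abs _ _).trans (le_trans (le_of_eq ?_) (herr (N + 1)))
      refine Finset.sum_congr rfl fun k _ => ?_
      rw [abs_mul, abs_of_nonneg (hp k)]
  have hlim1 := (hq.sub (hsum.mul_left F)).tendsto_sum_nat.comp (tendsto_add_atTop_nat 1) |>.abs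
  have hlim2 : Tendsto (fun N => √R * M * p N + kolmogorovConstant c / √R) atTop
      (𝓝 (kolmogorovConstant c / √R)) := by
    simpa using (hsum.summable.tendsto_atTop_zero.const_mul (√R * M)).add_const
      (kolmogorovConstant c / √R)
  have h := le_of_tendsto_of_tendsto' hlim1 hlim2 hbound
  rwa [mul_one] at h

theorem strictMono_kolmogorovConstant : StrictMono kolmogorovConstant := by
  intro x y hxy
  have := Real.exp_lt_exp.2 (by linarith : 1 + x < 1 + y)
  simp only [kolmogorovConstant]
  linarith

theorem kolmogorovDist_le {lam μ α : ℝ} (hlam : 0 < lam) (hμ : 0 < μ) (hα : 0 < α)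
    (hR : 1 ≤ offeredLoad lam μ) {π : Measure ℕ} (hπ : IsStationaryCustomerLaw n lam μ α π) :
    kolmogorovDist (scaledLaw n lam μ α π) (diffusionLaw n lam μ α) ≤
      kolmogorovConstant (α / μ) / √(offeredLoad lam μ) := by
  have := hπ.isProbabilityMeasure
  refine ciSup_le fun a => ?_
  -- Dividing all rates by `μ` changes only the unit of time, so the case of service rate one
  -- applies to the same `π`.
  have hbal : ∀ k, lam / μ * π.real {k} =
      departureRate n 1 (α / μ) (k + 1) * π.real {k + 1} := by
    intro k
    have h := hπ.detailedBalance hlam.le (departureRate_nonneg hμ.le hα.le)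
      (departureRate_zero n μ α) k
    rw [departureRate_div hμ, div_mul_eq_mul_div, h]
    ring
  have hfl : fluidEquilibrium n (lam / μ) 1 (α / μ) = fluidEquilibrium n lam μ α :=
    fluidEquilibrium_div hμ
  have hzeta : zeta n (lam / μ) 1 (α / μ) = zeta n lam μ α := by
    simp only [zeta, hfl, offeredLoad, div_one]
  have hq : HasSum (fun k => π.real {k} *
      if scaledState n (lam / μ) (α / μ) k ≤ a then 1 else 0)
      ((scaledLaw n lam μ α π).real (Set.Iic a)) := by
    rw [scaledLaw, map_measureReal_apply (measurable_of_countable _) measurableSet_Iic]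
    convert hasSum_real_singleton_indicator π _ using 1
    funext k
    simp only [scaledState, hfl, offeredLoad, mul_ite, mul_one, mul_zero]
    by_cases hk : ((k : ℝ) - fluidEquilibrium n lam μ α) / √(lam / μ) ≤ a
    · rw [if_pos hk, Set.indicator_of_mem
        (s := (fun k : ℕ => ((k : ℝ) - fluidEquilibrium n lam μ α) / √(lam / μ)) ⁻¹' Set.Iic a) hk]
    · rw [if_neg hk, Set.indicator_of_notMem
        (s := (fun k : ℕ => ((k : ℝ) - fluidEquilibrium n lam μ α) / √(lam / μ)) ⁻¹' Set.Iic a) hk]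
  have h := abs_tail_sub_le hR (div_pos hα hμ) (fun k => measureReal_nonneg)
    (hasSum_real_singleton π) hbal a hq
  rw [diffusionLaw_real_Iic hμ hα, ← hzeta]
  exact h

end Kolmogorov

end ErlangA

end

theorem theorem4 :
    ∃ C : ℝ → ℝ, StrictMonoOn C (Set.Ici 0) ∧ (∀ x : ℝ, 0 ≤ x → 0 ≤ C x) ∧
      ∀ (n : ℕ) (lam μ α : ℝ), 1 ≤ n → 0 < lam → 0 < μ → 0 < α →
        1 ≤ ErlangA.offeredLoad lam μ →
        ∀ π : MeasureTheory.Measure ℕ, ErlangA.IsStationaryCustomerLaw n lam μ α π →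
          ErlangA.kolmogorovDist (ErlangA.scaledLaw n lam μ α π)
              (ErlangA.diffusionLaw n lam μ α) ≤
            C (α / μ) / √(ErlangA.offeredLoad lam μ) := by
  refine ⟨ErlangA.kolmogorovConstant, ErlangA.strictMono_kolmogorovConstant.strictMonoOn _,
    fun x hx => ?_, fun n lam μ α _ hlam hμ hα hR π hπ =>
      ErlangA.kolmogorovDist_le hlam hμ hα hR hπ⟩
  unfold ErlangA.kolmogorovConstant
  positivity
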